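/- Let $n\ge 0$ and $N\ge 1$ be integers and let $r>0$. For $S\subseteq\mathbb{R}^m$ let $\mathcal{M}(S)$ be the set of Borel probability measures on $\mathbb{R}^m$ that are supported on $S$ (the complement of $S$ is a null set) and have finite second moment. Let $$\Xi=\{\xi\in\mathbb{R}^n \mid \xi^\top P_2\xi+2q_2^\top\xi+c_2\le 0\},$$ where $P_2\in\mathbb{R}^{n\times n}$ is symmetric positive definite, $q_2\in\mathbb{R}^n$, $c_2\in\mathbb{R}$, and assume that $\Xi$ has an interior point. Let $\zeta_1,\dots,\zeta_N\in\Xi$ and let $\mathbb{P}_0=\frac1N\sum_{i=1}^N\delta_{\zeta_i}$. The 2-Wasserstein distance of $\mu,\nu\in\mathcal{M}(\Xi)$ is defined by $$W_2(\mu,\nu)^2=\inf_{\pi}\int_{\Xi\times\Xi}\|z_1-z_2\|^2\,\pi(dz_1,dz_2),$$ where $\|\cdot\|$ is the Euclidean norm and $\pi$ ranges over the measures in $\mathcal{M}(\Xi\times\Xi)$ with marginals $\mu$ and $\nu$. Put $$\mathcal{P}=\{\mathbb{P}\in\mathcal{M}(\Xi)\mid W_2(\mathbb{P},\mathbb{P}_0)\le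 r\}.$$ Let $\ell(\xi)=\xi^\top P_1\xi+2q_1^\top\xi+c_1$ with an arbitrary symmetric $P_1\in\mathbb{R}^{n\times n}$, $q_1\in\mathbb{R}^n$ and $c_1\in\mathbb{R}$. Then $\ell$ is integrable with respect to every $\mathbb{P}\in\mathcal{P}$, and the optimal value $$v_{opt}=\sup_{\mathbb{P}\in\mathcal{P}}\mathbb{E}_{\mathbb{P}}[\ell(\xi)]$$ is finite and equal to the optimal value of the semidefinite program $$\inf_{\lambda\ge 0,\;\alpha_i\ge 0,\;\gamma_i\in\mathbb{R}}\ \lambda r^2+\frac1N\sum_{i=1}^N\gamma_i\qquad\text{s.t.}\quad \Omega(\lambda,\zeta_i,\alpha_i,-\gamma_i)\succeq 0,\quad i=1,\dots,N,$$ where $$\Omega(\lambda,\zeta,\alpha,t)=\begin{pmatrix}\lambda\|\zeta\|^2-c_1+\alpha c_2-t & (\alpha q_2-\lambda\zeta-q_1)^\top\\ \alpha q_2-\lambda\zeta-q_1 & \lambda I-P_1+\alpha P_2\end{pmatrix}.$$ -/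

import Mathlib

open MeasureTheory Matrix
open scoped ENNReal

noncomputable section

namespace WassersteinDRO

/-- The set `M(S)` of Borel probability measures supported on `S` with finite second moment. -/
def finiteSecondMoment {X : Type*} [NormedAddCommGroup X] [MeasurableSpace X] (S : Set X) :
    Set (Measure X) :=
  {μ | IsProbabilityMeasure μ ∧ μ Sᶜ = 0 ∧ ∫⁻ x, ‖x‖ₑ ^ 2 ∂μ < ∞}

/-- The set `Π(μ, ν)` of joint distributions in `M(Ξ × Ξ)` with marginals `μ` and `ν`. (The norm of
`X × X` is the maximum norm; it is equivalent to the Euclidean one, so that finiteness of the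
second moment means the same for both.) -/
def couplings {X : Type*} [NormedAddCommGroup X] [MeasurableSpace X] (Ξ : Set X)
    (μ ν : Measure X) : Set (Measure (X × X)) :=
  {π | π ∈ finiteSecondMoment (Ξ ×ˢ Ξ) ∧ π.map Prod.fst = μ ∧ π.map Prod.snd = ν}

/-- The 2-Wasserstein distance of two distributions on `Ξ`, as an extended nonnegative real. -/
def wasserstein2 {X : Type*} [NormedAddCommGroup X] [MeasurableSpace X] (Ξ : Set X)
    (μ ν : Measure X) : ℝ≥0∞ :=
  (⨅ π ∈ couplings Ξ μ ν, ∫⁻ z, ‖z.1 - z.2‖ₑ ^ 2 ∂π) ^ (1 / 2 : ℝ)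

/-- The Wasserstein ball of radius `r` around `μ₀` in `M(Ξ)`. -/
def ambiguitySet {X : Type*} [NormedAddCommGroup X] [MeasurableSpace X] (Ξ : Set X)
    (μ₀ : Measure X) (r : ℝ) : Set (Measure X) :=
  {μ | μ ∈ finiteSecondMoment Ξ ∧ wasserstein2 Ξ μ μ₀ ≤ ENNReal.ofReal r}

/-- The quadratic function `ξ ↦ ξᵀ P ξ + 2 qᵀ ξ + c` on `ℝⁿ`. -/
def quad {n : ℕ} (P : Matrix (Fin n) (Fin n) ℝ) (q : EuclideanSpace ℝ (Fin n)) (c : ℝ)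
    (ξ : EuclideanSpace ℝ (Fin n)) : ℝ :=
  ξ.ofLp ⬝ᵥ (P *ᵥ ξ.ofLp) + 2 * (q.ofLp ⬝ᵥ ξ.ofLp) + c

/-- The set `{ξ | ξᵀ P ξ + 2 qᵀ ξ + c ≤ 0}`, an ellipsoid for positive definite `P`. -/
def ellipsoid {n : ℕ} (P : Matrix (Fin n) (Fin n) ℝ) (q : EuclideanSpace ℝ (Fin n)) (c : ℝ) :
    Set (EuclideanSpace ℝ (Fin n)) :=
  {ξ | quad P q c ξ ≤ 0}

/-- The uniform (empirical) distribution `(1/N) ∑ i, δ_{ζ i}`. -/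
def empirical {X : Type*} [MeasurableSpace X] {N : ℕ} (ζ : Fin N → X) : Measure X :=
  (N : ℝ≥0∞)⁻¹ • ∑ i, Measure.dirac (ζ i)

/-- The symmetric `(1 + n) × (1 + n)` block matrix `Ω(lam, ζ, α, t)`. -/
def Omega {n : ℕ} (P₁ P₂ : Matrix (Fin n) (Fin n) ℝ) (q₁ q₂ : EuclideanSpace ℝ (Fin n))
    (c₁ c₂ : ℝ) (lam : ℝ) (ζ : EuclideanSpace ℝ (Fin n)) (α t : ℝ) :
    Matrix (Unit ⊕ Fin n) (Unit ⊕ Fin n) ℝ :=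
  Matrix.fromBlocks
    (Matrix.of fun _ _ => lam * ‖ζ‖ ^ 2 - c₁ + α * c₂ - t)
    (Matrix.replicateRow Unit (α • q₂ - lam • ζ - q₁).ofLp)
    (Matrix.replicateCol Unit (α • q₂ - lam • ζ - q₁).ofLp)
    (lam • (1 : Matrix (Fin n) (Fin n) ℝ) - P₁ + α • P₂)

/-- The set of objective values of the feasible points of the semidefinite program. -/
def sdpValues {n N : ℕ} (P₁ P₂ : Matrix (Fin n) (Fin n) ℝ) (q₁ q₂ : EuclideanSpace ℝ (Fin n))
    (c₁ c₂ : ℝ) (ζ : Fin N → EuclideanSpace ℝ (Fin n)) (r : ℝ) : Set ℝ :=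
  {v | ∃ (lam : ℝ) (α γ : Fin N → ℝ), 0 ≤ lam ∧ (∀ i, 0 ≤ α i) ∧
    (∀ i, (Omega P₁ P₂ q₁ q₂ c₁ c₂ lam (ζ i) (α i) (-γ i)).PosSemidef) ∧
    v = lam * r ^ 2 + 1 / (N : ℝ) * ∑ i, γ i}

end WassersteinDRO

end

/-!
Two applications of one elementary multiplier lemma, `exists_multiplier`, give the theorem.

*Duality over the Wasserstein ball.* If `ℓ x ≤ lam ‖x - ζ i‖² + γ i` on `Ξ` for all `i`, integration
against an almost optimal coupling gives `𝔼 ℓ ≤ lam r² + (1/N) ∑ γ i` (`integral_le_of_majorant`).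
Conversely, every tuple `ξ` of points of `Ξ` describes a transport plan that moves `ζ i` to `ξ i`,
and mixtures of two such plans are again plans. Hence, for a bound `v` of the expected loss, the
pairs (mean cost minus `r²`, `v` minus mean loss) of two tuples on either side of the cost
constraint are compatible, and a multiplier `lam ≥ 0` exists; the plan that moves nothing is a
Slater point because `r > 0`. Taking for `ξ i` the maximizers of `ℓ - lam ‖· - ζ i‖²` on the compact
set `Ξ` yields a majorant of objective value at most `v` (`exists_majorant`).

*The S-lemma.* That a quadratic function is nonnegative on the ellipsoid is equivalent to
positive semidefiniteness of its matrix plus a nonnegative multiple of the matrix of the ellipsoid.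
The compatibility condition for the multiplier follows by looking at the two zeros of the second
form on a line (`sLemma`). In homogeneous coordinates the ellipsoid has no points at infinity, as
`P₂` is positive definite, so that majorants are the same as feasible points of the semidefinite
program (`quad_le_of_posSemidef_Omega`, `exists_posSemidef_Omega`).
-/

/-! ### Multipliers and the S-lemma -/

namespace WassersteinDRO

/-- A one-constraint Lagrange multiplier exists as soon as the pairs of a positive and a negative
value of the constraint `g` are compatible: `-f x / g x ≤ f y / (-g y)`. -/
theorem exists_multiplier {S : Type*} (f g : S → ℝ) (hfg : ∀ x, g x ≤ 0 → 0 ≤ f x)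
    (hcross : ∀ x y, 0 < g x → g y < 0 → f x * g y ≤ f y * g x) (hslater : ∃ y, g y < 0) :
    ∃ α : ℝ, 0 ≤ α ∧ ∀ x, 0 ≤ f x + α * g x := by
  obtain ⟨y₀, hy₀⟩ := hslater
  obtain ⟨α, hα₁, hα₂⟩ := exists_between_of_forall_le
    (s := insert 0 {a : ℝ | ∃ x, 0 < g x ∧ a = -f x / g x})
    (t := {a : ℝ | ∃ y, g y < 0 ∧ a = f y / -g y}) ⟨0, Or.inl rfl⟩ ⟨_, y₀, hy₀, rfl⟩ (by
      rintro a (rfl | ⟨x, hx, rfl⟩) b ⟨y, hy, rfl⟩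
      · exact div_nonneg (hfg y hy.le) (by linarith)
      · rw [div_le_div_iff₀ hx (by linarith)]
        linarith [hcross x y hx hy])
  refine ⟨α, hα₁ (Or.inl rfl), fun x => ?_⟩
  rcases lt_trichotomy (g x) 0 with hx | hx | hx
  · have h := hα₂ ⟨x, hx, rfl⟩
    rw [le_div_iff₀ (by linarith)] at h
    linarith
  · have h := hfg x hx.le
    rw [hx]
    linarith
  · have h := hα₁ (Or.inr ⟨x, hx, rfl⟩)
    rw [div_le_iff₀ hx] at h
    linarith

/-- A real quadratic polynomial `a + t b + t² c` with `c < 0 < a` has a negative and a positive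
root. -/
theorem exists_roots_of_neg_of_pos {a b c : ℝ} (ha : 0 < a) (hc : c < 0) :
    ∃ t₁ t₂ : ℝ, t₁ < 0 ∧ 0 < t₂ ∧ a + t₁ * b + t₁ ^ 2 * c = 0 ∧ a + t₂ * b + t₂ ^ 2 * c = 0 := by
  have hac : a * c < 0 := mul_neg_of_pos_of_neg ha hc
  set s := Real.sqrt (b ^ 2 - 4 * a * c) with hs
  have hs2 : s ^ 2 = b ^ 2 - 4 * a * c := Real.sq_sqrt (by nlinarith [sq_nonneg b])
  have hbs : |b| < s := by
    rw [hs, ← Real.sqrt_sq_eq_abs]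
    exact Real.sqrt_lt_sqrt (sq_nonneg b) (by linarith)
  obtain ⟨h₁, h₂⟩ := abs_lt.1 hbs
  have hc0 : c ≠ 0 := hc.ne
  refine ⟨(s - b) / (2 * c), (-s - b) / (2 * c), div_neg_of_pos_of_neg (by linarith) (by linarith),
    div_pos_of_neg_of_neg (by linarith) (by linarith), ?_, ?_⟩
  · field_simp
    linear_combination hs2
  · field_simp
    linear_combination hs2

/-- The homogeneous S-lemma. The compatibility of a pair `x`, `y` of vectors with `G y < 0 < G x`
comes from the two zeros of `G` on the line `x + t y`, which lie on either side of `x`. -/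
theorem sLemma {V : Type*} [AddCommGroup V] [Module ℝ V] (F G : QuadraticForm ℝ V)
    (hFG : ∀ z, G z ≤ 0 → 0 ≤ F z) (hslater : ∃ y, G y < 0) :
    ∃ α : ℝ, 0 ≤ α ∧ ∀ z, 0 ≤ F z + α * G z := by
  refine exists_multiplier F G hFG (fun x y hx hy => ?_) hslater
  have expand : ∀ (Q : QuadraticForm ℝ V) (t : ℝ),
      Q (x + t • y) = Q x + t * QuadraticMap.polar Q x y + t ^ 2 * Q y := by
    intro Q t
    rw [QuadraticMap.map_add Q, QuadraticMap.map_smul, QuadraticMap.polar_smul_right]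
    simp only [smul_eq_mul]
    ring
  obtain ⟨t₁, t₂, ht₁, ht₂, h₁, h₂⟩ :=
    exists_roots_of_neg_of_pos (b := QuadraticMap.polar G x y) hx hy
  have hF₁ := hFG _ ((expand G t₁).trans h₁).le
  have hF₂ := hFG _ ((expand G t₂).trans h₂).le
  rw [expand] at hF₁ hF₂
  -- Eliminating `t²` with the equation `G (x + t y) = 0` leaves an affine function of `t`, which
  -- is of the right sign at `t₁ < 0` and at `t₂ > 0`, hence at `0`.
  set p := QuadraticMap.polar F x y
  set q := QuadraticMap.polar G x y
  have k₁ : (F x * G y - F y * G x) + t₁ * (p * G y - F y * q) ≤ 0 := by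
    have := mul_nonpos_of_nonneg_of_nonpos hF₁ hy.le
    linear_combination this - F y * h₁
  have k₂ : (F x * G y - F y * G x) + t₂ * (p * G y - F y * q) ≤ 0 := by
    have := mul_nonpos_of_nonneg_of_nonpos hF₂ hy.le
    linear_combination this - F y * h₂
  rcases le_total 0 (p * G y - F y * q) with h | h
  · nlinarith [mul_nonneg ht₂.le h]
  · nlinarith [mul_nonneg_of_nonpos_of_nonpos ht₁.le h]

/-! ### The matrix `Omega` and the ellipsoid -/

/-- The homogenization `(s, x) ↦ xᵀ P x + 2 s qᵀ x + c s²` of `quad P q c`. -/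
def homogQuad {n : ℕ} (P : Matrix (Fin n) (Fin n) ℝ) (q : EuclideanSpace ℝ (Fin n)) (c s : ℝ)
    (x : EuclideanSpace ℝ (Fin n)) : ℝ :=
  x.ofLp ⬝ᵥ (P *ᵥ x.ofLp) + 2 * s * (q.ofLp ⬝ᵥ x.ofLp) + c * s ^ 2

variable {n : ℕ}

theorem homogQuad_one (P : Matrix (Fin n) (Fin n) ℝ) (q : EuclideanSpace ℝ (Fin n)) (c : ℝ)
    (x : EuclideanSpace ℝ (Fin n)) : homogQuad P q c 1 x = quad P q c x := by
  simp [homogQuad, quad]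

theorem homogQuad_of_ne_zero (P : Matrix (Fin n) (Fin n) ℝ) (q : EuclideanSpace ℝ (Fin n)) (c : ℝ)
    {s : ℝ} (hs : s ≠ 0) (x : EuclideanSpace ℝ (Fin n)) :
    homogQuad P q c s x = s ^ 2 * quad P q c (s⁻¹ • x) := by
  simp only [homogQuad, quad, WithLp.ofLp_smul, mulVec_smul, smul_dotProduct, dotProduct_smul,
    smul_eq_mul]
  field_simp

theorem norm_sq_eq_dotProduct (x : EuclideanSpace ℝ (Fin n)) : ‖x‖ ^ 2 = x.ofLp ⬝ᵥ x.ofLp := by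
  rw [EuclideanSpace.real_norm_sq_eq]
  simp [dotProduct, pow_two]

/-- The quadratic form of `Omega` is the homogenization of
`ξ ↦ lam ‖ξ - ζ‖² - quad P₁ q₁ c₁ ξ + α * quad P₂ q₂ c₂ ξ - t`. -/
theorem dotProduct_Omega_mulVec (P₁ P₂ : Matrix (Fin n) (Fin n) ℝ)
    (q₁ q₂ : EuclideanSpace ℝ (Fin n)) (c₁ c₂ lam : ℝ) (ζ : EuclideanSpace ℝ (Fin n)) (α t s : ℝ)
    (x : EuclideanSpace ℝ (Fin n)) :
    Sum.elim (fun _ : Unit => s) x.ofLp ⬝ᵥ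
        (Omega P₁ P₂ q₁ q₂ c₁ c₂ lam ζ α t *ᵥ Sum.elim (fun _ : Unit => s) x.ofLp) =
      lam * ‖x - s • ζ‖ ^ 2 - homogQuad P₁ q₁ c₁ s x + α * homogQuad P₂ q₂ c₂ s x - t * s ^ 2 := by
  have h₁ : Matrix.replicateRow Unit (α • q₂ - lam • ζ - q₁).ofLp *ᵥ x.ofLp =
      fun _ => (α • q₂ - lam • ζ - q₁).ofLp ⬝ᵥ x.ofLp := rfl
  have h₂ : Matrix.replicateCol Unit (α • q₂ - lam • ζ - q₁).ofLp *ᵥ (fun _ : Unit => s) =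
      s • (α • q₂ - lam • ζ - q₁).ofLp := by
    ext i
    simp [mulVec, dotProduct, mul_comm]
  have h₃ : ∀ a : ℝ, (Matrix.of fun _ _ : Unit => a) *ᵥ (fun _ : Unit => s) = fun _ => a * s := by
    intro a
    ext i
    simp [mulVec, dotProduct]
  rw [Omega, fromBlocks_mulVec, Sum.elim_comp_inl, Sum.elim_comp_inr, sumElim_dotProduct_sumElim,
    h₁, h₂, h₃]
  simp only [norm_sq_eq_dotProduct, homogQuad, WithLp.ofLp_smul, WithLp.ofLp_sub, add_mulVec,
    sub_mulVec, smul_mulVec, one_mulVec, dotProduct_add, dotProduct_sub, sub_dotProduct,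
    dotProduct_smul, smul_dotProduct, smul_eq_mul]
  rw [dotProduct_comm x.ofLp ζ.ofLp, dotProduct_comm x.ofLp q₂.ofLp, dotProduct_comm x.ofLp q₁.ofLp]
  simp only [dotProduct, Finset.univ_unique, Finset.sum_singleton]
  ring

theorem isHermitian_Omega {P₁ P₂ : Matrix (Fin n) (Fin n) ℝ} (hP₁ : P₁.IsSymm) (hP₂ : P₂.IsSymm)
    (q₁ q₂ : EuclideanSpace ℝ (Fin n)) (c₁ c₂ lam : ℝ) (ζ : EuclideanSpace ℝ (Fin n)) (α t : ℝ) :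
    (Omega P₁ P₂ q₁ q₂ c₁ c₂ lam ζ α t).IsHermitian := by
  refine IsHermitian.fromBlocks ?_ ?_ ?_
  · ext i j
    simp
  · ext i j
    simp
  · change (lam • (1 : Matrix (Fin n) (Fin n) ℝ) - P₁ + α • P₂)ᴴ = _
    rw [conjTranspose_eq_transpose_of_trivial]
    simp [hP₁.eq, hP₂.eq]

theorem continuous_quad (P : Matrix (Fin n) (Fin n) ℝ) (q : EuclideanSpace ℝ (Fin n)) (c : ℝ) :
    Continuous (quad P q c) := by
  unfold quad
  simp only [dotProduct, mulVec]
  fun_prop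

theorem dotProduct_mulVec_pos_of_ne_zero {P : Matrix (Fin n) (Fin n) ℝ} (hP : P.PosDef)
    {x : EuclideanSpace ℝ (Fin n)} (hx : x ≠ 0) : 0 < x.ofLp ⬝ᵥ (P *ᵥ x.ofLp) := by
  have h : x.ofLp ≠ 0 := fun h => hx (by ext i; simp [h])
  simpa using hP.dotProduct_mulVec_pos h

theorem exists_coercive {P : Matrix (Fin n) (Fin n) ℝ} (hP : P.PosDef) :
    ∃ m : ℝ, 0 < m ∧ ∀ x : EuclideanSpace ℝ (Fin n), m * ‖x‖ ^ 2 ≤ x.ofLp ⬝ᵥ (P *ᵥ x.ofLp) := by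
  have hcont : Continuous fun x : EuclideanSpace ℝ (Fin n) => x.ofLp ⬝ᵥ (P *ᵥ x.ofLp) := by
    simp only [dotProduct, mulVec]
    fun_prop
  obtain h | hne := (Metric.sphere (0 : EuclideanSpace ℝ (Fin n)) 1).eq_empty_or_nonempty
  · refine ⟨1, one_pos, fun x => ?_⟩
    have hx : x = 0 := by
      by_contra hx
      have : ‖x‖⁻¹ • x ∈ Metric.sphere (0 : EuclideanSpace ℝ (Fin n)) 1 := by
        simp [norm_smul, hx]
      simp [h] at this
    simp [hx]
  · obtain ⟨u, hu, hmin⟩ := (isCompact_sphere _ _).exists_isMinOn hne hcont.continuousOn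
    have hu0 : u ≠ 0 := by
      rintro rfl
      simp at hu
    refine ⟨_, dotProduct_mulVec_pos_of_ne_zero hP hu0, fun x => ?_⟩
    rcases eq_or_ne x 0 with rfl | hx
    · simp
    · have h := hmin (show ‖x‖⁻¹ • x ∈ Metric.sphere (0 : EuclideanSpace ℝ (Fin n)) 1 by
        simp [norm_smul, hx])
      simp only [Set.mem_ofPred_eq, WithLp.ofLp_smul, mulVec_smul, smul_dotProduct, dotProduct_smul,
        smul_eq_mul] at h
      have hx' : 0 < ‖x‖ := norm_pos_iff.2 hx
      calc _ ≤ (‖x‖⁻¹ * (‖x‖⁻¹ * (x.ofLp ⬝ᵥ (P *ᵥ x.ofLp)))) * ‖x‖ ^ 2 := by gcongr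
        _ = _ := by field_simp

theorem isCompact_ellipsoid {P : Matrix (Fin n) (Fin n) ℝ} (hP : P.PosDef)
    (q : EuclideanSpace ℝ (Fin n)) (c : ℝ) : IsCompact (ellipsoid P q c) := by
  refine Metric.isCompact_of_isClosed_isBounded
    (isClosed_le (continuous_quad P q c) continuous_const) ?_
  obtain ⟨m, hm, hcoer⟩ := exists_coercive hP
  refine isBounded_iff_forall_norm_le.2 ⟨(2 * ‖q‖ + |c|) / m + 1, fun x hx => ?_⟩
  have hx : x.ofLp ⬝ᵥ (P *ᵥ x.ofLp) + 2 * (q.ofLp ⬝ᵥ x.ofLp) + c ≤ 0 := hx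
  have hin : |q.ofLp ⬝ᵥ x.ofLp| ≤ ‖q‖ * ‖x‖ := by
    have := abs_real_inner_le_norm x q
    rw [EuclideanSpace.inner_eq_star_dotProduct] at this
    simpa [mul_comm] using this
  have hmain : m * ‖x‖ ^ 2 ≤ 2 * (‖q‖ * ‖x‖) + |c| := by
    linarith [hcoer x, neg_abs_le (q.ofLp ⬝ᵥ x.ofLp), neg_abs_le c]
  by_contra! hlt
  have hd : 0 ≤ (2 * ‖q‖ + |c|) / m := by positivity
  have h1 : 1 < ‖x‖ := by linarith
  have h2 : 2 * ‖q‖ + |c| < m * ‖x‖ := by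
    have : (2 * ‖q‖ + |c|) / m < ‖x‖ := by linarith
    rwa [div_lt_iff₀' hm] at this
  nlinarith [mul_lt_mul_of_pos_right h2 (by linarith : 0 < ‖x‖),
    mul_le_mul_of_nonneg_left h1.le (abs_nonneg c)]

/-- In positive dimension, an ellipsoid with an interior point has a Slater point, by strict
convexity. -/
theorem exists_quad_neg {P : Matrix (Fin n) (Fin n) ℝ} (hP : P.PosDef)
    {q : EuclideanSpace ℝ (Fin n)} {c : ℝ} (hint : (interior (ellipsoid P q c)).Nonempty)
    {d : EuclideanSpace ℝ (Fin n)} (hd : d ≠ 0) : ∃ x, quad P q c x < 0 := by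
  obtain ⟨x, hx⟩ := hint
  have hopen : IsOpen ((fun t : ℝ => (x + t • d, x - t • d)) ⁻¹'
      (interior (ellipsoid P q c) ×ˢ interior (ellipsoid P q c))) :=
    (isOpen_interior.prod isOpen_interior).preimage (by fun_prop)
  obtain ⟨ε, hε, hball⟩ := Metric.isOpen_iff.1 hopen 0 (by simp [hx])
  obtain ⟨h₁, h₂⟩ := hball (show ε / 2 ∈ Metric.ball (0 : ℝ) ε by
    rw [Metric.mem_ball, dist_zero_right, Real.norm_eq_abs, abs_of_pos (by positivity)]
    linarith)
  have h₁ : quad P q c (x + (ε / 2) • d) ≤ 0 := (interior_subset h₁ : _ ∈ ellipsoid P q c)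
  have h₂ : quad P q c (x - (ε / 2) • d) ≤ 0 := (interior_subset h₂ : _ ∈ ellipsoid P q c)
  have hpos := dotProduct_mulVec_pos_of_ne_zero hP hd
  refine ⟨x, ?_⟩
  have key : quad P q c (x + (ε / 2) • d) + quad P q c (x - (ε / 2) • d) =
      2 * quad P q c x + 2 * ((ε / 2) ^ 2 * (d.ofLp ⬝ᵥ (P *ᵥ d.ofLp))) := by
    simp only [quad, WithLp.ofLp_add, WithLp.ofLp_sub, WithLp.ofLp_smul, mulVec_add, mulVec_sub,
      mulVec_smul, dotProduct_add, dotProduct_sub, add_dotProduct, sub_dotProduct, smul_dotProduct,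
      dotProduct_smul, smul_eq_mul]
    ring
  have : 0 < (ε / 2) ^ 2 * (d.ofLp ⬝ᵥ (P *ᵥ d.ofLp)) := by positivity
  linarith

/-- A feasible point of the semidefinite program gives a quadratic majorant of the loss. -/
theorem quad_le_of_posSemidef_Omega {P₁ P₂ : Matrix (Fin n) (Fin n) ℝ}
    {q₁ q₂ : EuclideanSpace ℝ (Fin n)} {c₁ c₂ lam : ℝ} {ζ : EuclideanSpace ℝ (Fin n)} {α γ : ℝ}
    (hα : 0 ≤ α) (h : (Omega P₁ P₂ q₁ q₂ c₁ c₂ lam ζ α (-γ)).PosSemidef)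
    {x : EuclideanSpace ℝ (Fin n)} (hx : x ∈ ellipsoid P₂ q₂ c₂) :
    quad P₁ q₁ c₁ x ≤ lam * ‖x - ζ‖ ^ 2 + γ := by
  have h0 := h.dotProduct_mulVec_nonneg (Sum.elim (fun _ : Unit => (1 : ℝ)) x.ofLp)
  rw [star_trivial, dotProduct_Omega_mulVec, homogQuad_one, homogQuad_one, one_smul] at h0
  have : α * quad P₂ q₂ c₂ x ≤ 0 := mul_nonpos_of_nonneg_of_nonpos hα hx
  linarith

/-- By the S-lemma, every quadratic majorant of the loss on the ellipsoid is certified by a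
positive semidefinite `Omega`. -/
theorem exists_posSemidef_Omega {P₁ P₂ : Matrix (Fin n) (Fin n) ℝ} (hP₁ : P₁.IsSymm)
    (hP₂ : P₂.PosDef) {q₁ q₂ : EuclideanSpace ℝ (Fin n)} {c₁ c₂ : ℝ}
    (hint : (interior (ellipsoid P₂ q₂ c₂)).Nonempty) {lam : ℝ} {ζ : EuclideanSpace ℝ (Fin n)}
    {γ : ℝ} (hmaj : ∀ x ∈ ellipsoid P₂ q₂ c₂, quad P₁ q₁ c₁ x ≤ lam * ‖x - ζ‖ ^ 2 + γ) :
    ∃ α : ℝ, 0 ≤ α ∧ (Omega P₁ P₂ q₁ q₂ c₁ c₂ lam ζ α (-γ)).PosSemidef := by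
  have hsymm : P₂.IsSymm := by
    simpa [IsSymm, IsHermitian, conjTranspose_eq_transpose_of_trivial] using hP₂.isHermitian
  suffices ∃ α : ℝ, 0 ≤ α ∧ ∀ (s : ℝ) (x : EuclideanSpace ℝ (Fin n)),
      0 ≤ lam * ‖x - s • ζ‖ ^ 2 - homogQuad P₁ q₁ c₁ s x + α * homogQuad P₂ q₂ c₂ s x
        - -γ * s ^ 2 by
    obtain ⟨α, hα, h⟩ := this
    refine ⟨α, hα, .of_dotProduct_mulVec_nonneg (isHermitian_Omega hP₁ hsymm ..) fun z => ?_⟩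
    have hz : z = Sum.elim (fun _ : Unit => z (Sum.inl ())) (WithLp.toLp 2 (z ∘ Sum.inr)).ofLp := by
      ext (i | i) <;> rfl
    rw [star_trivial, hz, dotProduct_Omega_mulVec]
    exact h _ _
  have hF : ∀ (s : ℝ) (x : EuclideanSpace ℝ (Fin n)), homogQuad P₂ q₂ c₂ s x ≤ 0 →
      0 ≤ lam * ‖x - s • ζ‖ ^ 2 - homogQuad P₁ q₁ c₁ s x - -γ * s ^ 2 := by
    intro s x hsx
    rcases eq_or_ne s 0 with rfl | hs
    -- `P₂` is positive definite: the quadric has no points at infinity.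
    · have hx : x = 0 := by
        by_contra hx
        have := dotProduct_mulVec_pos_of_ne_zero hP₂ hx
        simp only [homogQuad] at hsx
        linarith
      simp [hx, homogQuad]
    · have hs2 : 0 < s ^ 2 := by positivity
      rw [homogQuad_of_ne_zero _ _ _ hs] at hsx
      have h := hmaj (s⁻¹ • x) (nonpos_of_mul_nonpos_right hsx hs2)
      have hn : ‖x - s • ζ‖ ^ 2 = s ^ 2 * ‖s⁻¹ • x - ζ‖ ^ 2 := by
        rw [← sq_abs s, ← Real.norm_eq_abs, ← mul_pow, ← norm_smul, smul_sub, smul_inv_smul₀ hs]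
      rw [homogQuad_of_ne_zero _ _ _ hs, hn]
      linarith [mul_le_mul_of_nonneg_left h hs2.le]
  rcases Nat.eq_zero_or_pos n with rfl | hn
  -- In dimension zero there may be no Slater point, but every point is in the ellipsoid.
  · refine ⟨0, le_rfl, fun s x => ?_⟩
    obtain ⟨y, hy⟩ := hint
    have hy : quad P₂ q₂ c₂ y ≤ 0 := (interior_subset hy : _ ∈ ellipsoid P₂ q₂ c₂)
    have hc : homogQuad P₂ q₂ c₂ s x ≤ 0 := by
      simp only [quad, homogQuad, dotProduct, Finset.univ_eq_empty, Finset.sum_empty] at hy ⊢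
      nlinarith [sq_nonneg s]
    linarith [hF s x hc]
  · have hd : (EuclideanSpace.single ⟨0, hn⟩ 1 : EuclideanSpace ℝ (Fin n)) ≠ 0 := by simp
    obtain ⟨y, hy⟩ := exists_quad_neg hP₂ hint hd
    have heval : ∀ (M : Matrix (Unit ⊕ Fin n) (Unit ⊕ Fin n) ℝ) z,
        M.toQuadraticForm' z = z ⬝ᵥ (M *ᵥ z) := by
      intro M z
      simp [Matrix.toQuadraticForm', toLinearMap₂'_apply']
    obtain ⟨α, hα, h⟩ := sLemma
      (Omega P₁ P₂ q₁ q₂ c₁ c₂ lam ζ 0 (-γ)).toQuadraticForm'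
      (Omega 0 P₂ 0 q₂ 0 c₂ 0 ζ 1 0).toQuadraticForm'
      (fun z hz => by
        have hz' : z = Sum.elim (fun _ : Unit => z (Sum.inl ()))
            (WithLp.toLp 2 (z ∘ Sum.inr)).ofLp := by
          ext (i | i) <;> rfl
        rw [heval, hz', dotProduct_Omega_mulVec] at hz ⊢
        have := hF (z (Sum.inl ())) (WithLp.toLp 2 (z ∘ Sum.inr)) (by
          simpa [homogQuad] using hz)
        linarith)
      ⟨Sum.elim (fun _ : Unit => (1 : ℝ)) y.ofLp, by
        rw [heval, dotProduct_Omega_mulVec, homogQuad_one, homogQuad_one]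
        simpa [quad] using hy⟩
    refine ⟨α, hα, fun s x => ?_⟩
    have h := h (Sum.elim (fun _ : Unit => s) x.ofLp)
    rw [heval, heval, dotProduct_Omega_mulVec, dotProduct_Omega_mulVec] at h
    have h0 : homogQuad (0 : Matrix (Fin n) (Fin n) ℝ) 0 0 s x = 0 := by simp [homogQuad]
    rw [h0] at h
    linarith

/-! ### Couplings with an empirical distribution -/


section Transport

variable {X : Type*} [NormedAddCommGroup X] [MeasurableSpace X] [BorelSpace X]

theorem integrable_of_continuous_of_compact {Y : Type*} [TopologicalSpace Y] [T2Space Y]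
    [MeasurableSpace Y] [OpensMeasurableSpace Y] {K : Set Y} (hK : IsCompact K) {μ : Measure Y}
    [IsFiniteMeasure μ] (hμ : μ Kᶜ = 0) {f : Y → ℝ} (hf : Continuous f) : Integrable f μ := by
  have h : IntegrableOn f K μ := hf.continuousOn.integrableOn_of_subset_isCompact hK
    hK.measurableSet subset_rfl (measure_ne_top μ K)
  rwa [IntegrableOn, Measure.restrict_eq_self_of_ae_mem] at h
  exact mem_ae_iff.2 hμ

theorem mem_finiteSecondMoment_of_compact {K : Set X} (hK : IsCompact K) {μ : Measure X}
    [IsProbabilityMeasure μ] (hμ : μ Kᶜ = 0) : μ ∈ finiteSecondMoment K := by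
  refine ⟨inferInstance, hμ, ?_⟩
  have h := (integrable_of_continuous_of_compact hK hμ (continuous_norm.pow 2)).hasFiniteIntegral
  simpa [HasFiniteIntegral, enorm_pow] using h

/-- Mean of `f` over the empirical distribution. -/
theorem integral_empirical {Y : Type*} [MeasurableSpace Y] {N : ℕ}
    (ζ : Fin N → Y) {f : Y → ℝ} (hf : StronglyMeasurable f) :
    ∫ y, f y ∂(empirical ζ) = 1 / (N : ℝ) * ∑ i, f (ζ i) := by
  rw [empirical, integral_smul_measure, integral_finsetSum_measure]
  · simp [integral_dirac' f _ hf]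
  · exact fun i _ => (integrable_dirac' hf (by simp))

theorem isProbabilityMeasure_empirical {Y : Type*} [MeasurableSpace Y] {N : ℕ} (hN : 0 < N)
    (ζ : Fin N → Y) : IsProbabilityMeasure (empirical ζ) := by
  refine ⟨?_⟩
  simp only [empirical, Measure.smul_apply, Measure.finsetSum_apply, measure_univ, smul_eq_mul,
    Finset.sum_const, Finset.card_univ, Fintype.card_fin, nsmul_eq_mul, mul_one]
  exact ENNReal.inv_mul_cancel (by simpa using hN.ne') (ENNReal.natCast_ne_top N)

theorem empirical_compl_eq_zero {Y : Type*} [MeasurableSpace Y] {N : ℕ} (ζ : Fin N → Y) {K : Set Y}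
    (hK : MeasurableSet K) (hζ : ∀ i, ζ i ∈ K) : empirical ζ Kᶜ = 0 := by
  simp [empirical, Measure.finsetSum_apply, hK.compl, hζ]

theorem map_empirical {Y Z : Type*} [MeasurableSpace Y] [MeasurableSpace Z] {N : ℕ} (ζ : Fin N → Y)
    {f : Y → Z} (hf : Measurable f) : (empirical ζ).map f = empirical (f ∘ ζ) := by
  ext s hs
  simp [empirical, Measure.map_apply hf hs, Measure.finsetSum_apply, Measure.dirac_apply', hs,
    hf hs, Set.indicator]
  rfl

variable [SecondCountableTopology X]

theorem lintegral_enorm_sub_sq {K : Set X} (hK : IsCompact K) {π : Measure (X × X)}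
    [IsFiniteMeasure π] (hπ : π (K ×ˢ K)ᶜ = 0) :
    ∫⁻ z, ‖z.1 - z.2‖ₑ ^ 2 ∂π = ENNReal.ofReal (∫ z, ‖z.1 - z.2‖ ^ 2 ∂π) := by
  rw [ofReal_integral_eq_lintegral_ofReal
    (integrable_of_continuous_of_compact (hK.prod hK) hπ (by fun_prop))
    (Filter.Eventually.of_forall fun z => by positivity)]
  refine lintegral_congr fun z => ?_
  rw [ENNReal.ofReal_pow (norm_nonneg _), ofReal_norm]

theorem wasserstein2_le_of_coupling {K : Set X} (hK : IsCompact K) {μ ν : Measure X}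
    {π : Measure (X × X)} (hπ : π ∈ couplings K μ ν) {r : ℝ} (hr : 0 ≤ r)
    (h : ∫ z, ‖z.1 - z.2‖ ^ 2 ∂π ≤ r ^ 2) : wasserstein2 K μ ν ≤ ENNReal.ofReal r := by
  have := hπ.1.1
  have h₁ : (⨅ π ∈ couplings K μ ν, ∫⁻ z, ‖z.1 - z.2‖ₑ ^ 2 ∂π) ≤ ENNReal.ofReal (r ^ 2) :=
    (iInf₂_le π hπ).trans (by
      rw [lintegral_enorm_sub_sq hK hπ.1.2.1]
      exact ENNReal.ofReal_le_ofReal h)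
  calc wasserstein2 K μ ν ≤ ENNReal.ofReal (r ^ 2) ^ (1 / 2 : ℝ) :=
        ENNReal.rpow_le_rpow h₁ (by norm_num)
    _ = ENNReal.ofReal r := by
        rw [ENNReal.ofReal_rpow_of_nonneg (sq_nonneg r) (by norm_num), ← Real.sqrt_eq_rpow,
          Real.sqrt_sq hr]

theorem exists_coupling_of_wasserstein2_le {K : Set X} (hK : IsCompact K) {μ ν : Measure X} {r : ℝ}
    (hr : 0 ≤ r) (h : wasserstein2 K μ ν ≤ ENNReal.ofReal r) {ε : ℝ} (hε : 0 < ε) :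
    ∃ π ∈ couplings K μ ν, ∫ z, ‖z.1 - z.2‖ ^ 2 ∂π ≤ r ^ 2 + ε := by
  have h₁ : (⨅ π ∈ couplings K μ ν, ∫⁻ z, ‖z.1 - z.2‖ₑ ^ 2 ∂π) ≤ ENNReal.ofReal (r ^ 2) := by
    have h2 := ENNReal.rpow_le_rpow h (show (0 : ℝ) ≤ 2 by norm_num)
    rw [wasserstein2, ← ENNReal.rpow_mul, ENNReal.ofReal_rpow_of_nonneg hr (by norm_num)] at h2
    simpa using h2
  have h₂ := h₁.trans_lt ((ENNReal.ofReal_lt_ofReal_iff (by positivity)).2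
    (show r ^ 2 < r ^ 2 + ε by linarith))
  obtain ⟨π, hπ, hlt⟩ := by simpa only [iInf_lt_iff, exists_prop] using h₂
  have := hπ.1.1
  rw [lintegral_enorm_sub_sq hK hπ.1.2.1] at hlt
  exact ⟨π, hπ, ((ENNReal.ofReal_lt_ofReal_iff (by positivity)).1 hlt).le⟩

/-! ### Lagrangian duality over the Wasserstein ball -/

/-- Weak duality: a majorant `lam ‖ξ - ζ i‖² + γ i` of the loss bounds its expectation over the
Wasserstein ball. -/
theorem integral_le_of_majorant {K : Set X} (hK : IsCompact K) {ℓ : X → ℝ} (hℓ : Continuous ℓ)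
    {N : ℕ} (hN : 0 < N) {ζ : Fin N → X} (hζ : ∀ i, ζ i ∈ K) {r : ℝ} (hr : 0 ≤ r) {lam : ℝ}
    (hlam : 0 ≤ lam) {γ : Fin N → ℝ} (hmaj : ∀ i, ∀ x ∈ K, ℓ x ≤ lam * ‖x - ζ i‖ ^ 2 + γ i)
    {μ : Measure X} (hμ : μ ∈ ambiguitySet K (empirical ζ) r) :
    ∫ x, ℓ x ∂μ ≤ lam * r ^ 2 + 1 / (N : ℝ) * ∑ i, γ i := by
  have hne : K.Nonempty := ⟨_, hζ ⟨0, hN⟩⟩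
  -- The least `h` with `ℓ x ≤ lam ‖x - z‖² + h z`. It replaces `γ` because it is a function of the
  -- sample point (which may occur several times, with different `γ i`), and it is continuous.
  let φ : X → X → ℝ := fun z x => ℓ x - lam * ‖x - z‖ ^ 2
  let h : X → ℝ := fun z => sSup (φ z '' K)
  have hφ : ∀ z, Continuous (φ z) := fun z => by fun_prop
  have hh : Continuous h := hK.continuous_sSup (f := φ) (by
    change Continuous fun p : X × X => ℓ p.2 - lam * ‖p.2 - p.1‖ ^ 2
    fun_prop)
  have hle : ∀ z, ∀ x ∈ K, ℓ x ≤ lam * ‖x - z‖ ^ 2 + h z := by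
    intro z x hx
    have : φ z x ≤ h z := le_csSup (hK.image (hφ z)).bddAbove (Set.mem_image_of_mem _ hx)
    simp only [φ] at this
    linarith
  have hγ : ∀ i, h (ζ i) ≤ γ i := by
    intro i
    refine csSup_le (hne.image _) ?_
    rintro _ ⟨x, hx, rfl⟩
    simp only [φ]
    linarith [hmaj i x hx]
  have key : ∀ ε > 0, ∫ x, ℓ x ∂μ ≤ lam * (r ^ 2 + ε) + 1 / (N : ℝ) * ∑ i, γ i := by
    intro ε hε
    obtain ⟨π, hπ, hcost⟩ := exists_coupling_of_wasserstein2_le hK hr hμ.2 hε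
    have := hπ.1.1
    have hsupp := hπ.1.2.1
    have hint : ∀ {f : X × X → ℝ}, Continuous f → Integrable f π := fun hf =>
      integrable_of_continuous_of_compact (hK.prod hK) hsupp hf
    calc ∫ x, ℓ x ∂μ = ∫ z, ℓ z.1 ∂π := by
          rw [← hπ.2.1, integral_map measurable_fst.aemeasurable hℓ.aestronglyMeasurable]
      _ ≤ ∫ z, (lam * ‖z.1 - z.2‖ ^ 2 + h z.2) ∂π := by
          refine integral_mono_ae (hint (by fun_prop)) (hint (by fun_prop)) ?_
          filter_upwards [mem_ae_iff.2 hsupp] with z hz using hle z.2 z.1 hz.1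
      _ = lam * ∫ z, ‖z.1 - z.2‖ ^ 2 ∂π + ∫ y, h y ∂(empirical ζ) := by
          rw [integral_add (hint (by fun_prop)) (hint (by fun_prop)), integral_const_mul,
            ← hπ.2.2, integral_map measurable_snd.aemeasurable hh.aestronglyMeasurable]
      _ ≤ lam * (r ^ 2 + ε) + 1 / (N : ℝ) * ∑ i, γ i := by
          rw [integral_empirical ζ hh.stronglyMeasurable]
          gcongr with i
          exact hγ i
  refine le_of_forall_pos_le_add fun δ hδ => ?_
  have h1 := key (δ / (lam + 1)) (by positivity)
  have h2 : lam * (δ / (lam + 1)) ≤ δ := by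
    rw [mul_div_assoc', div_le_iff₀ (by positivity)]
    nlinarith
  linarith

/-- Two tuples of transport targets for the sample points, used with weights `a` and `b`, give a
coupling whose first marginal lies in the Wasserstein ball if the mean transport cost is at most
`r²`. -/
theorem exists_mem_ambiguitySet {K : Set X} (hK : IsCompact K) {ℓ : X → ℝ} (hℓ : Continuous ℓ)
    {N : ℕ} (hN : 0 < N) {ζ ξ η : Fin N → X} (hζ : ∀ i, ζ i ∈ K) (hξ : ∀ i, ξ i ∈ K)
    (hη : ∀ i, η i ∈ K) {r : ℝ} (hr : 0 ≤ r) {a b : ℝ} (ha : 0 ≤ a) (hb : 0 ≤ b) (hab : a + b = 1)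
    (hcost : a * (1 / (N : ℝ) * ∑ i, ‖ξ i - ζ i‖ ^ 2) + b * (1 / (N : ℝ) * ∑ i, ‖η i - ζ i‖ ^ 2)
      ≤ r ^ 2) :
    ∃ μ ∈ ambiguitySet K (empirical ζ) r,
      ∫ x, ℓ x ∂μ = a * (1 / (N : ℝ) * ∑ i, ℓ (ξ i)) + b * (1 / (N : ℝ) * ∑ i, ℓ (η i)) := by
  have hE : ∀ {Y : Type _} [MeasurableSpace Y] (θ : Fin N → Y),
      IsProbabilityMeasure (empirical θ) := fun θ => isProbabilityMeasure_empirical hN θ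
  have hab' : ENNReal.ofReal a + ENNReal.ofReal b = 1 := by
    rw [← ENNReal.ofReal_add ha hb, hab, ENNReal.ofReal_one]
  let π : Measure (X × X) := ENNReal.ofReal a • empirical (fun i => (ξ i, ζ i)) +
    ENNReal.ofReal b • empirical (fun i => (η i, ζ i))
  have hπP : IsProbabilityMeasure π := ⟨by
    have h1 := (hE fun i => (ξ i, ζ i)).measure_univ
    have h2 := (hE fun i => (η i, ζ i)).measure_univ
    simp [π, h1, h2, hab']⟩
  have hKm : MeasurableSet (K ×ˢ K) := hK.measurableSet.prod hK.measurableSet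
  have hsupp : π (K ×ˢ K)ᶜ = 0 := by
    simp [π, empirical_compl_eq_zero _ hKm (fun i => Set.mk_mem_prod (hξ i) (hζ i)),
      empirical_compl_eq_zero _ hKm (fun i => Set.mk_mem_prod (hη i) (hζ i))]
  have hπint : ∀ {f : X × X → ℝ}, Continuous f → ∫ z, f z ∂π =
      a * (1 / (N : ℝ) * ∑ i, f (ξ i, ζ i)) + b * (1 / (N : ℝ) * ∑ i, f (η i, ζ i)) := by
    intro f hf
    have hi : ∀ θ : Fin N → X × X, (∀ i, θ i ∈ K ×ˢ K) → Integrable f (empirical θ) :=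
      fun θ hθ => by
        have := hE θ
        exact integrable_of_continuous_of_compact (hK.prod hK) (empirical_compl_eq_zero _ hKm hθ) hf
    rw [integral_add_measure ((hi _ fun i => ⟨hξ i, hζ i⟩).smul_measure ENNReal.ofReal_ne_top)
      ((hi _ fun i => ⟨hη i, hζ i⟩).smul_measure ENNReal.ofReal_ne_top), integral_smul_measure,
      integral_smul_measure, integral_empirical _ hf.stronglyMeasurable,
      integral_empirical _ hf.stronglyMeasurable, ENNReal.toReal_ofReal ha,
      ENNReal.toReal_ofReal hb, smul_eq_mul, smul_eq_mul]
  have hsnd : π.map Prod.snd = empirical ζ := by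
    simp only [π]
    rw [Measure.map_add _ _ measurable_snd, Measure.map_smul, Measure.map_smul,
      map_empirical _ measurable_snd, map_empirical _ measurable_snd]
    change ENNReal.ofReal a • empirical ζ + ENNReal.ofReal b • empirical ζ = _
    rw [← add_smul, hab', one_smul]
  have hμP : IsProbabilityMeasure (π.map Prod.fst) :=
    Measure.isProbabilityMeasure_map measurable_fst.aemeasurable
  have hμsupp : (π.map Prod.fst) Kᶜ = 0 := by
    rw [Measure.map_apply measurable_fst hK.measurableSet.compl]
    refine measure_mono_null (fun z hz => ?_) hsupp
    exact fun hz' => hz hz'.1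
  refine ⟨π.map Prod.fst, ⟨mem_finiteSecondMoment_of_compact hK hμsupp,
    wasserstein2_le_of_coupling hK
      ⟨mem_finiteSecondMoment_of_compact (hK.prod hK) hsupp, rfl, hsnd⟩ hr ?_⟩, ?_⟩
  · rw [hπint (by fun_prop)]
    exact hcost
  · rw [integral_map measurable_fst.aemeasurable hℓ.aestronglyMeasurable, hπint (by fun_prop)]

/-- Strong duality: an upper bound of the expected loss over the Wasserstein ball is an upper bound
of the objective value of some majorant `lam ‖ξ - ζ i‖² + γ i` of the loss. -/
theorem exists_majorant {K : Set X} (hK : IsCompact K) {ℓ : X → ℝ} (hℓ : Continuous ℓ)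
    {N : ℕ} (hN : 0 < N) {ζ : Fin N → X} (hζ : ∀ i, ζ i ∈ K) {r : ℝ} (hr : 0 < r) {v : ℝ}
    (hv : ∀ μ ∈ ambiguitySet K (empirical ζ) r, ∫ x, ℓ x ∂μ ≤ v) :
    ∃ (lam : ℝ) (γ : Fin N → ℝ), 0 ≤ lam ∧ (∀ i, ∀ x ∈ K, ℓ x ≤ lam * ‖x - ζ i‖ ^ 2 + γ i) ∧
      lam * r ^ 2 + 1 / (N : ℝ) * ∑ i, γ i ≤ v := by
  -- The multiplier of the constraint that the mean transport cost is at most `r²`; leaving the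
  -- sample points where they are is a Slater point.
  obtain ⟨lam, hlam, h⟩ := exists_multiplier
    (fun ξ : Fin N → K => v - 1 / (N : ℝ) * ∑ i, ℓ (ξ i))
    (fun ξ => 1 / (N : ℝ) * ∑ i, ‖(ξ i : X) - ζ i‖ ^ 2 - r ^ 2)
    (fun ξ hξ => by
      obtain ⟨μ, hμ, hint⟩ := exists_mem_ambiguitySet hK hℓ hN hζ (fun i => (ξ i).2)
        (fun i => (ξ i).2) hr.le (a := 1) (b := 0) zero_le_one le_rfl (by simp)
        (by linarith)
      have := hv μ hμ
      linarith)
    (fun ξ η hξ hη => by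
      -- The mixture of `ξ` and `η` whose mean transport cost is exactly `r²`.
      set A := 1 / (N : ℝ) * ∑ i, ‖(ξ i : X) - ζ i‖ ^ 2 - r ^ 2 with hA
      set B := 1 / (N : ℝ) * ∑ i, ‖(η i : X) - ζ i‖ ^ 2 - r ^ 2 with hB
      have hAB : 0 < A - B := by linarith
      obtain ⟨μ, hμ, hint⟩ := exists_mem_ambiguitySet hK hℓ hN hζ (fun i => (ξ i).2)
        (fun i => (η i).2) hr.le (a := -B / (A - B)) (b := A / (A - B))
        (div_nonneg (by linarith) hAB.le) (div_nonneg hξ.le hAB.le)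
        (by field_simp; ring)
        (by
          rw [show 1 / (N : ℝ) * ∑ i, ‖(ξ i : X) - ζ i‖ ^ 2 = A + r ^ 2 by rw [hA]; ring,
            show 1 / (N : ℝ) * ∑ i, ‖(η i : X) - ζ i‖ ^ 2 = B + r ^ 2 by rw [hB]; ring]
          apply le_of_eq
          field_simp
          ring)
      have h1 := hv μ hμ
      rw [hint, div_mul_eq_mul_div (-B), div_mul_eq_mul_div A, ← add_div, div_le_iff₀ hAB] at h1
      linarith)
    ⟨fun i => ⟨ζ i, hζ i⟩, by simpa using pow_pos hr 2⟩
  have hmax : ∀ i, ∃ x ∈ K, IsMaxOn (fun x => ℓ x - lam * ‖x - ζ i‖ ^ 2) K x := fun i =>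
    hK.exists_isMaxOn ⟨_, hζ i⟩ (by fun_prop)
  choose ξ hξ hmax using hmax
  refine ⟨lam, fun i => ℓ (ξ i) - lam * ‖ξ i - ζ i‖ ^ 2, hlam, fun i x hx => ?_, ?_⟩
  · have := hmax i hx
    simp only [Set.mem_ofPred_eq] at this
    linarith
  · have h1 := h fun i => ⟨ξ i, hξ i⟩
    simp only at h1
    rw [Finset.sum_sub_distrib, ← Finset.mul_sum]
    linarith

end Transport

end WassersteinDRO

open WassersteinDRO

theorem mainTheorem2 {n N : ℕ} (hN : 0 < N)
    (P₁ P₂ : Matrix (Fin n) (Fin n) ℝ) (q₁ q₂ : EuclideanSpace ℝ (Fin n)) (c₁ c₂ : ℝ)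
    (hP₁ : P₁.IsSymm) (hP₂ : P₂.PosDef)
    (hΞ : (interior (WassersteinDRO.ellipsoid P₂ q₂ c₂)).Nonempty)
    (ζ : Fin N → EuclideanSpace ℝ (Fin n))
    (hζ : ∀ i, ζ i ∈ WassersteinDRO.ellipsoid P₂ q₂ c₂)
    (r : ℝ) (hr : 0 < r) :
    (∀ μ ∈ WassersteinDRO.ambiguitySet (WassersteinDRO.ellipsoid P₂ q₂ c₂)
        (WassersteinDRO.empirical ζ) r,
      Integrable (WassersteinDRO.quad P₁ q₁ c₁) μ) ∧
    ∃ v_opt : ℝ,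
      IsLUB ((fun μ : Measure (EuclideanSpace ℝ (Fin n)) =>
          ∫ ξ, WassersteinDRO.quad P₁ q₁ c₁ ξ ∂μ) ''
        WassersteinDRO.ambiguitySet (WassersteinDRO.ellipsoid P₂ q₂ c₂)
          (WassersteinDRO.empirical ζ) r) v_opt ∧
      IsGLB (WassersteinDRO.sdpValues P₁ P₂ q₁ q₂ c₁ c₂ ζ r) v_opt := by
  have hK := isCompact_ellipsoid hP₂ q₂ c₂
  have hℓ := continuous_quad P₁ q₁ c₁
  refine ⟨fun μ hμ => ?_, ?_⟩
  · have := hμ.1.1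
    exact integrable_of_continuous_of_compact hK hμ.1.2.1 hℓ
  have hweak : ∀ μ ∈ ambiguitySet (ellipsoid P₂ q₂ c₂) (empirical ζ) r,
      ∀ v ∈ sdpValues P₁ P₂ q₁ q₂ c₁ c₂ ζ r, ∫ ξ, quad P₁ q₁ c₁ ξ ∂μ ≤ v := by
    rintro μ hμ _ ⟨lam, α, γ, hlam, hα, hΩ, rfl⟩
    exact integral_le_of_majorant hK hℓ hN hζ hr.le hlam
      (fun i x hx => quad_le_of_posSemidef_Omega (hα i) (hΩ i) hx) hμ
  have hstrong : ∀ v, (∀ μ ∈ ambiguitySet (ellipsoid P₂ q₂ c₂) (empirical ζ) r,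
      ∫ ξ, quad P₁ q₁ c₁ ξ ∂μ ≤ v) → ∃ w ∈ sdpValues P₁ P₂ q₁ q₂ c₁ c₂ ζ r, w ≤ v := by
    intro v hv
    obtain ⟨lam, γ, hlam, hmaj, hle⟩ := exists_majorant hK hℓ hN hζ hr hv
    choose α hα hΩ using fun i => exists_posSemidef_Omega hP₁ hP₂ hΞ (hmaj i)
    exact ⟨_, ⟨lam, α, γ, hlam, hα, hΩ, rfl⟩, hle⟩
  -- The loss is bounded on the compact ellipsoid, so its expectations are bounded as well.
  obtain ⟨M, hM⟩ := (hK.image hℓ).bddAbove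
  have hbdd : ∀ μ ∈ ambiguitySet (ellipsoid P₂ q₂ c₂) (empirical ζ) r,
      ∫ ξ, quad P₁ q₁ c₁ ξ ∂μ ≤ M := by
    intro μ hμ
    have := hμ.1.1
    calc ∫ ξ, quad P₁ q₁ c₁ ξ ∂μ ≤ ∫ _, M ∂μ := by
          refine integral_mono_ae (integrable_of_continuous_of_compact hK hμ.1.2.1 hℓ)
            (integrable_const M) ?_
          filter_upwards [mem_ae_iff.2 hμ.1.2.1] with x hx using hM (Set.mem_image_of_mem _ hx)
      _ = M := by simp
  obtain ⟨μ₀, hμ₀, -⟩ := exists_mem_ambiguitySet hK hℓ hN hζ hζ hζ hr.le (a := 1) (b := 0)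
    zero_le_one le_rfl (by simp) (by simpa using sq_nonneg r)
  have hlub := isLUB_csSup (Set.Nonempty.image (fun μ => ∫ ξ, quad P₁ q₁ c₁ ξ ∂μ) ⟨μ₀, hμ₀⟩)
    ⟨M, by rintro _ ⟨μ, hμ, rfl⟩; exact hbdd μ hμ⟩
  refine ⟨_, hlub, fun w hw => hlub.2 ?_, fun u hu => ?_⟩
  · rintro _ ⟨μ, hμ, rfl⟩
    exact hweak μ hμ w hw
  · obtain ⟨w, hw, hle⟩ := hstrong _ fun μ hμ => hlub.1 ⟨μ, hμ, rfl⟩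
    exact (hu hw).trans hle
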